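/- Let $m>0$ and let $k\in\mathbb Z\setminus\{0\}$ (so $k=k_j=\pm(j+\tfrac12)$ for some $j\in\{\tfrac12,\tfrac32,\dots\}$; the operators below do not depend on $m_j$). For a real potential $V$ on $(0,\infty)$ consider the radial Dirac expression $$\tau_V\begin{pmatrix}f\\g\end{pmatrix}=\begin{pmatrix}m+V&-\frac{d}{dr}+\frac{k}{r}\\[2pt]\frac{d}{dr}+\frac{k}{r}&-m+V\end{pmatrix}\begin{pmatrix}f\\g\end{pmatrix}.$$ For $\mu\in\mathbb R$ and $\epsilon>0$ put $V_{\mu,\epsilon}=\frac{\mu}{2\epsilon}\chi_{(1-\epsilon,1+\epsilon)}$ and let $h(\mu,\epsilon)_{m_j,k_j}$ be the operator in $L^2(0,\infty)^2=L^2((0,\infty),dr;\mathbb C^2)$ acting by $\tau_{V_{\mu,\epsilon}}$ on $$\{\varphi\in L^2(0,\infty)^2:\ \tau_{V_{\mu,\epsilon}}\varphi\in L^2(0,\infty)^2,\ \varphi\in AC(0,\infty)^2\}.$$ For $\lambda\in\mathbb R$ put $M_\lambda^\pm=\begin{pmatrix}\lambda/2&\pm1\\ \mp1&\lambda/2\end{pmatrix}$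 and let $h(\lambda)_{m_j,k_j}$ be the operator acting by $\tau_0$ (almost everywhere on $(0,1)\cup(1,\infty)$) on $$\{\varphi\in L^2(0,\infty)^2:\ \tau_0\varphi\in L^2(0,\infty)^2,\ \varphi\in AC((0,1)\cup(1,\infty))^2,\ M_\lambda^-\varphi(1^+)+M_\lambda^+\varphi(1^-)=0\}.$$ Here $AC(U)$ is the space of complex functions on the open set $U$ that are absolutely continuous on every compact interval contained in $U$, and $\varphi(1^\pm)$ denote one-sided limits at $1$. Write $\sigma_p$ for the set of eigenvalues. **Theorem.** Let $\mu\in\mathbb R\setminus\{0\}$ with $\cos(\mu/2)\neq0$, and let $\lambda=2\tan(\mu/2)$. Let $E\subset(0,\infty)$ be a set with $0\in\overline E$ (for instance all sufficiently small $\epsilon>0$, or the terms of a sequence tending to $0$), and for each $\epsilon\in E$ let $a_\epsilon\in\mathbb R$ satisfy $a_\epsilon\in\sigma_p(h(\mu,\epsilon)_{m_j,k_j})$. If $a_\epsilon\to a$ as $E\ni\epsilon\to0$, for some $a\in(-m,m)$, then $a\in\sigma_p(h(\lambda)_{m_j,k_j})$. -/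

import Mathlib

open Set Filter Topology MeasureTheory

noncomputable section

namespace DiracShell

/-- Two-component radial functions `φ = (f, g)`; only their restriction to `(0, ∞)` matters. -/
abbrev RadialSpinor : Type := ℝ → Fin 2 → ℂ

/-- Lebesgue measure on the half-line `(0, ∞)`. -/
def halfLine : Measure ℝ := volume.restrict (Ioi 0)

/-- `φ ∈ L²(0, ∞)²`. -/
def IsL2 (φ : RadialSpinor) : Prop :=
  ∀ i, MemLp (fun r => φ r i) 2 halfLine

/-- `φ ∈ AC(U)²` for an open set `U`: both components are absolutely continuous on every
compact interval contained in `U`. -/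
def IsAC (U : Set ℝ) (φ : RadialSpinor) : Prop :=
  ∀ i, ∀ x y : ℝ, uIcc x y ⊆ U → AbsolutelyContinuousOnInterval (fun r => φ r i) x y

/-- The radial Dirac expression with electrostatic potential `V`,
`(f, g) ↦ ((m + V) f + (-d/dr + k/r) g, (d/dr + k/r) f + (-m + V) g)`.
It is applied only to absolutely continuous functions, which are differentiable a.e. -/
def radialDirac (m : ℝ) (k : ℤ) (V : ℝ → ℝ) (φ : RadialSpinor) : RadialSpinor := fun r =>
  ![((m + V r : ℝ) : ℂ) * φ r 0 + (-deriv (fun s => φ s 1) r + ((k / r : ℝ) : ℂ) * φ r 1),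
    (deriv (fun s => φ s 0) r + ((k / r : ℝ) : ℂ) * φ r 0) + ((-m + V r : ℝ) : ℂ) * φ r 1]

/-- The shrinking potential `(μ / (2ε)) χ_{(1-ε, 1+ε)}`. -/
def shortRange (μ ε : ℝ) : ℝ → ℝ :=
  (Ioo (1 - ε) (1 + ε)).indicator fun _ => μ / (2 * ε)

/-- The domain of `h(μ, ε)`: all `φ ∈ L²(0, ∞)² ∩ AC(0, ∞)²` with `h(μ, ε) φ ∈ L²(0, ∞)²`. -/
def shortRangeDomain (m : ℝ) (k : ℤ) (μ ε : ℝ) : Set RadialSpinor :=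
  {φ | IsL2 φ ∧ IsL2 (radialDirac m k (shortRange μ ε) φ) ∧ IsAC (Ioi 0) φ}

/-- The matrix `M⁺_λ`. -/
def matPlus (lam : ℝ) : Matrix (Fin 2) (Fin 2) ℂ :=
  !![(lam : ℂ) / 2, 1; -1, (lam : ℂ) / 2]

/-- The matrix `M⁻_λ`. -/
def matMinus (lam : ℝ) : Matrix (Fin 2) (Fin 2) ℂ :=
  !![(lam : ℂ) / 2, -1; 1, (lam : ℂ) / 2]

/-- The transmission condition `M⁻_λ φ(1⁺) + M⁺_λ φ(1⁻) = 0`, including the existence of the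
one-sided limits `φ(1⁺)` and `φ(1⁻)`. -/
def Transmission (lam : ℝ) (φ : RadialSpinor) : Prop :=
  ∃ vPlus vMinus : Fin 2 → ℂ,
    Tendsto φ (𝓝[>] 1) (𝓝 vPlus) ∧ Tendsto φ (𝓝[<] 1) (𝓝 vMinus) ∧
      (matMinus lam).mulVec vPlus + (matPlus lam).mulVec vMinus = 0

/-- The domain of the `δ`-shell operator `h(λ)`: all `φ ∈ L²(0, ∞)² ∩ AC((0,1) ∪ (1,∞))²` with
`h φ ∈ L²(0, ∞)²` that satisfy the transmission condition at `1`. -/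
def shellDomain (m : ℝ) (k : ℤ) (lam : ℝ) : Set RadialSpinor :=
  {φ | IsL2 φ ∧ IsL2 (radialDirac m k 0 φ) ∧ IsAC (Ioo 0 1 ∪ Ioi 1) φ ∧ Transmission lam φ}

/-- The point spectrum (set of eigenvalues) of the operator in `L²(0, ∞)²` with domain `D` and
action `T`; functions are identified when they agree a.e. on `(0, ∞)`. -/
def pointSpectrum (D : Set RadialSpinor) (T : RadialSpinor → RadialSpinor) : Set ℂ :=
  {z | ∃ φ ∈ D, ¬ φ =ᵐ[halfLine] 0 ∧ T φ =ᵐ[halfLine] fun r => z • φ r}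

/-- `σ_p(h(μ, ε))`. -/
def shortRangePointSpectrum (m : ℝ) (k : ℤ) (μ ε : ℝ) : Set ℂ :=
  pointSpectrum (shortRangeDomain m k μ ε) (radialDirac m k (shortRange μ ε))

/-- `σ_p(h(λ))`. -/
def shellPointSpectrum (m : ℝ) (k : ℤ) (lam : ℝ) : Set ℂ :=
  pointSpectrum (shellDomain m k lam) (radialDirac m k 0)

end DiracShell

end

/-! Everything rests on the quantity `Re (f ḡ)`. Along a solution with energy `|e| < m` the terms in
`k / r` cancel and its derivative is `(m + e) |g|² + (m - e) |f|²`, so it is monotone. For `k ≠ 0`,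
square integrability near `0` forces `Re (f ḡ) ≥ 0` there, and square integrability at infinity
forces `Re (f ḡ) ≤ 0` (`crossTerm_nonneg`, `crossTerm_nonpos`). Conversely these signs bound the
`L²` mass by an increment of `Re (f ḡ)` (`integrableOn_Ioc_zero`, `integrableOn_Ioi`). Being in `L²`
is thus traded for a sign, which survives pointwise limits.

Normalize the eigenfunctions for `μ, ε` at `1 - ε` and take a limit `(x, y)` of these values by
compactness. On the support of the potential, mass, energy and centrifugal term contribute only
`O(ε)`, so the value at `1 + ε` tends to `(x, y)` rotated by the angle `μ` (`norm_sub_rotation_le`).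
Grönwall makes the eigenfunctions converge on both sides of the shell to solutions with energy `a`
(`DiracODE.tendsto`). The limits inherit the signs, hence lie in `L²`, and for `λ = 2 tan (μ / 2)`
the rotation is exactly the transmission condition (`transmission_rotation`). The glued function is
the eigenfunction sought (`mem_shellPointSpectrum`). -/

noncomputable section

namespace DiracShell

/-! ### Regularity and Grönwall estimates -/

/-- A function that is absolutely continuous on compact subintervals of an open set and whose
derivative agrees a.e. with a continuous function is continuously differentiable there. -/
theorem hasDerivAt_of_absolutelyContinuous {f G : ℝ → ℂ} {s : Set ℝ} (hs : IsOpen s)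
    (hf : ∀ x y : ℝ, uIcc x y ⊆ s → AbsolutelyContinuousOnInterval f x y)
    (hG : ContinuousOn G s) (h : ∀ᵐ r, r ∈ s → deriv f r = G r) :
    ∀ r ∈ s, HasDerivAt f (G r) r := by
  intro r hr
  obtain ⟨η, hη, hball⟩ := Metric.isOpen_iff.1 hs r hr
  set x := r - η / 2 with hx
  set y := r + η / 2 with hy
  have hxy : x ≤ y := by linarith
  have hsub : Icc x y ⊆ s := by
    intro t ht
    apply hball
    rw [Metric.mem_ball, Real.dist_eq, abs_lt]
    constructor <;> linarith [ht.1, ht.2]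
  -- The primitive of `G` is Lipschitz near `r`. Subtracting it from `f` leaves an absolutely
  -- continuous function with derivative zero a.e., hence a constant.
  have hP : ∀ t ∈ Icc x y, HasDerivAt (fun t => ∫ u in x..t, G u) (G t) t := by
    intro t ht
    apply intervalIntegral.integral_hasDerivAt_right
    · apply (hG.mono _).intervalIntegrable
      rw [uIcc_of_le ht.1]
      exact (Icc_subset_Icc_right ht.2).trans hsub
    · exact hG.stronglyMeasurableAtFilter hs t (hsub ht)
    · exact hG.continuousAt (hs.mem_nhds (hsub ht))
  obtain ⟨C, hC⟩ := isCompact_Icc.exists_bound_of_continuousOn (hG.mono hsub)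
  have hPac : AbsolutelyContinuousOnInterval (fun t => ∫ u in x..t, G u) x y := by
    apply LipschitzOnWith.absolutelyContinuousOnInterval (K := C.toNNReal)
    rw [uIcc_of_le hxy]
    apply (convex_Icc x y).lipschitzOnWith_of_nnnorm_hasDerivWithin_le
      (fun t ht => (hP t ht).hasDerivWithinAt)
    intro t ht
    rw [← NNReal.coe_le_coe, coe_nnnorm]
    exact (hC t ht).trans (Real.le_coe_toNNReal C)
  have hfac := hf x y (by rwa [uIcc_of_le hxy])
  obtain ⟨c, hc⟩ := (hfac.sub hPac).const_of_ae_hasDerivAt_zero (by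
    filter_upwards [h, hfac.boundedVariationOn.ae_differentiableAt_of_mem_uIcc] with t h1 h2 ht
    have h3 := (h2 ht).hasDerivAt
    rw [uIcc_of_le hxy] at ht
    rw [h1 (hsub ht)] at h3
    simpa using h3.sub (hP t ht))
  have hrmem : r ∈ Ioo x y := ⟨by linarith, by linarith⟩
  have := (hP r (Ioo_subset_Icc_self hrmem)).const_add c
  refine this.congr_of_eventuallyEq ?_
  filter_upwards [Icc_mem_nhds hrmem.1 hrmem.2] with t ht
  have := hc t (by rwa [uIcc_of_le hxy])
  rw [← this]
  simp

/-- The inequality `exp z - 1 ≤ z exp z` removes the quotient `ε / K`, so later estimates need not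
separate `K = 0`. -/
theorem gronwallBound_le {δ K ε x : ℝ} (hK : 0 ≤ K) (hε : 0 ≤ ε) :
    gronwallBound δ K ε x ≤ (δ + ε * x) * Real.exp (K * x) := by
  rcases hK.eq_or_lt with rfl | hK
  · simp [gronwallBound_K0]
  rw [gronwallBound_of_K_ne_0 hK.ne']
  have h1 : Real.exp (K * x) - 1 ≤ K * x * Real.exp (K * x) := by
    have h2 := Real.add_one_le_exp (-(K * x))
    have h3 : Real.exp (-(K * x)) * Real.exp (K * x) = 1 := by
      rw [← Real.exp_add]; simp
    nlinarith [Real.exp_pos (K * x)]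
  have h2 : ε / K * (Real.exp (K * x) - 1) ≤ ε / K * (K * x * Real.exp (K * x)) := by gcongr
  have h3 : ε / K * (K * x * Real.exp (K * x)) = ε * x * Real.exp (K * x) := by
    field_simp
  simp only
  linarith

section Gronwall

variable {F : Type*} [NormedAddCommGroup F] [NormedSpace ℝ F]

theorem norm_le_of_norm_hasDerivAt_le_forward {y y' : ℝ → F} {α β K δ : ℝ} (hK : 0 ≤ K)
    (hδ : 0 ≤ δ) (hc : ContinuousOn y (Icc α β)) (hd : ∀ t ∈ Ioo α β, HasDerivAt y (y' t) t)
    (hb : ∀ t ∈ Ioo α β, ‖y' t‖ ≤ K * ‖y t‖ + δ) {s t : ℝ} (hs : α ≤ s) (hst : s ≤ t)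
    (ht : t ≤ β) :
    ‖y t‖ ≤ (‖y s‖ + δ * (β - α)) * Real.exp (K * (β - α)) := by
  have hαβ : 0 ≤ β - α := by linarith
  rcases hst.eq_or_lt with rfl | hst
  · have h1 : 1 ≤ Real.exp (K * (β - α)) := Real.one_le_exp (by positivity)
    have h2 : 0 ≤ δ * (β - α) := by positivity
    nlinarith [norm_nonneg (y s)]
  -- Nothing is known about the derivative at `s = α`, so Grönwall starts at an interior `u`, which
  -- then tends to `s`.
  have key : ∀ u ∈ Ioo s t,
      ‖y t‖ ≤ (‖y u‖ + δ * (β - α)) * Real.exp (K * (β - α)) := by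
    intro u hu
    have h1 := norm_le_gronwallBound_of_norm_deriv_right_le (f := y) (f' := y') (K := K)
      (ε := δ) (δ := ‖y u‖) (a := u) (b := t)
      (hc.mono (Icc_subset_Icc (hs.trans hu.1.le) ht))
      (fun x hx => (hd x ⟨by linarith [hu.1, hx.1], by linarith [hx.2]⟩).hasDerivWithinAt)
      le_rfl (fun x hx => hb x ⟨by linarith [hu.1, hx.1], by linarith [hx.2]⟩) t
      ⟨hu.2.le, le_rfl⟩
    refine h1.trans ((gronwallBound_le hK hδ).trans ?_)
    have : t - u ≤ β - α := by linarith [hu.1]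
    gcongr
  have hcs : ContinuousWithinAt y (Ioo s t) s :=
    (hc s ⟨hs, hst.le.trans ht⟩).mono
      (Ioo_subset_Icc_self.trans (Icc_subset_Icc hs ht))
  have hlim : Tendsto (fun u => (‖y u‖ + δ * (β - α)) * Real.exp (K * (β - α)))
      (𝓝[Ioo s t] s) (𝓝 ((‖y s‖ + δ * (β - α)) * Real.exp (K * (β - α)))) :=
    (hcs.tendsto.norm.add_const _).mul_const _
  have : (𝓝[Ioo s t] s).NeBot := by
    rw [nhdsWithin_Ioo_eq_nhdsGT hst]; infer_instance
  exact ge_of_tendsto hlim (eventually_mem_nhdsWithin.mono key)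

/-- Grönwall's inequality in both directions of time, with the differential inequality assumed
only in the open interval. -/
theorem norm_le_of_norm_hasDerivAt_le {y y' : ℝ → F} {α β K δ : ℝ} (hK : 0 ≤ K)
    (hδ : 0 ≤ δ) (hc : ContinuousOn y (Icc α β)) (hd : ∀ t ∈ Ioo α β, HasDerivAt y (y' t) t)
    (hb : ∀ t ∈ Ioo α β, ‖y' t‖ ≤ K * ‖y t‖ + δ) {s t : ℝ} (hs : s ∈ Icc α β)
    (ht : t ∈ Icc α β) :
    ‖y t‖ ≤ (‖y s‖ + δ * (β - α)) * Real.exp (K * (β - α)) := by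
  rcases le_total s t with hst | hst
  · exact norm_le_of_norm_hasDerivAt_le_forward hK hδ hc hd hb hs.1 hst ht.2
  · have h := norm_le_of_norm_hasDerivAt_le_forward (y := fun u => y (-u))
      (y' := fun u => -y' (-u)) (α := -β) (β := -α) (s := -s) (t := -t) hK hδ
      (hc.comp continuousOn_neg (fun u hu => ⟨by linarith [hu.2], by linarith [hu.1]⟩))
      (fun u hu => by
        have := (hd (-u) ⟨by linarith [hu.2], by linarith [hu.1]⟩).scomp u (hasDerivAt_neg u)
        rwa [neg_one_smul] at this)
      (fun u hu => by
        simpa using hb (-u) ⟨by linarith [hu.2], by linarith [hu.1]⟩)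
      (by linarith [hs.2]) (by linarith) (by linarith [ht.1])
    simpa [neg_add_eq_sub] using h

end Gronwall

/-! ### The Dirac system: symmetry, comparison and uniqueness of solutions -/

/-- The free radial Dirac system `τ₀ (f, g) = e (f, g)`, solved for the derivatives. A constant
potential `v` amounts to the energy shift from `e` to `e - v`. -/
def DiracODE (m k e : ℝ) (s : Set ℝ) (f g : ℝ → ℂ) : Prop :=
  ∀ r ∈ s,
    HasDerivAt f (((-(k / r) : ℝ) : ℂ) * f r + ((m + e : ℝ) : ℂ) * g r) r ∧
    HasDerivAt g (((k / r : ℝ) : ℂ) * g r + ((m - e : ℝ) : ℂ) * f r) r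

theorem IsAC.continuousOn {φ : RadialSpinor} (hφ : IsAC (Ioi 0) φ) (i : Fin 2) :
    ContinuousOn (fun r => φ r i) (Ioi 0) := by
  intro r hr
  have h0 : (0 : ℝ) < r := hr
  have h1 := (hφ i (r / 2) (r + 1) (by
    rw [uIcc_of_le (by linarith)]
    exact fun t ht => lt_of_lt_of_le (half_pos h0) ht.1)).continuousOn
  rw [uIcc_of_le (by linarith)] at h1
  exact (h1.continuousAt (Icc_mem_nhds (by linarith) (by linarith))).continuousWithinAt

namespace DiracODE

variable {m k e : ℝ} {s : Set ℝ} {f g : ℝ → ℂ}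

theorem mono (h : DiracODE m k e s f g) {t : Set ℝ} (hts : t ⊆ s) : DiracODE m k e t f g :=
  fun r hr => h r (hts hr)

theorem const_mul (h : DiracODE m k e s f g) (c : ℂ) :
    DiracODE m k e s (fun r => c * f r) (fun r => c * g r) := by
  intro r hr
  obtain ⟨h1, h2⟩ := h r hr
  constructor
  · convert! h1.const_mul c using 1
    ring
  · convert! h2.const_mul c using 1
    ring

theorem continuousOn_fst (h : DiracODE m k e s f g) : ContinuousOn f s :=
  fun r hr => (h r hr).1.continuousAt.continuousWithinAt

theorem continuousOn_snd (h : DiracODE m k e s f g) : ContinuousOn g s :=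
  fun r hr => (h r hr).2.continuousAt.continuousWithinAt

/-- This symmetry reduces negative `k` to positive `k`, and statements on `g` to statements on `f`.
-/
theorem swap (h : DiracODE m k e s f g) : DiracODE m (-k) (-e) s g f := by
  intro r hr
  obtain ⟨h1, h2⟩ := h r hr
  constructor
  · convert! h2 using 4
    ring
  · convert! h1 using 4 <;> ring

theorem zero : DiracODE m k e s 0 0 := by
  intro r _
  simp [hasDerivAt_zero]

theorem norm_linear_le {c d : ℝ} {x y : ℂ} {A B : ℝ} (hc : |c| ≤ A) (hd : |d| ≤ B) :
    ‖(c : ℂ) * x + (d : ℂ) * y‖ ≤ (A + B) * ‖(x, y)‖ := by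
  have h1 : ‖x‖ ≤ ‖(x, y)‖ := norm_fst_le (x, y)
  have h2 : ‖y‖ ≤ ‖(x, y)‖ := norm_snd_le (x, y)
  calc ‖(c : ℂ) * x + (d : ℂ) * y‖ ≤ |c| * ‖x‖ + |d| * ‖y‖ := by
        refine (norm_add_le _ _).trans ?_
        simp
    _ ≤ A * ‖(x, y)‖ + B * ‖(x, y)‖ := by
        have := (abs_nonneg c).trans hc
        have := (abs_nonneg d).trans hd
        gcongr
    _ = _ := by ring

theorem norm_swap (x y : ℂ) : ‖(y, x)‖ = ‖(x, y)‖ := by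
  simp [Prod.norm_def, max_comm]

/-- Two solutions of radial Dirac systems with different parameters stay close. -/
theorem norm_sub_le {m' k' e' α β M : ℝ} {F G : ℝ → ℂ} (hα : 0 < α)
    (h : DiracODE m k e (Ioo α β) f g) (h' : DiracODE m' k' e' (Ioo α β) F G)
    (hf : ContinuousOn f (Icc α β)) (hg : ContinuousOn g (Icc α β))
    (hF : ContinuousOn F (Icc α β)) (hG : ContinuousOn G (Icc α β))
    (hM0 : 0 ≤ M) (hM : ∀ t ∈ Ioo α β, ‖(F t, G t)‖ ≤ M) {s t : ℝ} (hs : s ∈ Icc α β)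
    (ht : t ∈ Icc α β) :
    ‖(f t - F t, g t - G t)‖ ≤
      (‖(f s - F s, g s - G s)‖ + (|k - k'| / α + (|m - m'| + |e - e'|)) * M * (β - α)) *
        Real.exp ((|k| / α + (|m| + |e|)) * (β - α)) := by
  have hbound : ∀ (κ : ℝ) (r : ℝ), r ∈ Ioo α β → |κ / r| ≤ |κ| / α := by
    intro κ r hr
    rw [abs_div, abs_of_pos (hα.trans hr.1)]
    have := hr.1
    gcongr
  refine norm_le_of_norm_hasDerivAt_le (y := fun t => (f t - F t, g t - G t))
    (y' := fun r =>
      ((((-(k / r) : ℝ) : ℂ) * f r + ((m + e : ℝ) : ℂ) * g r) -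
        (((-(k' / r) : ℝ) : ℂ) * F r + ((m' + e' : ℝ) : ℂ) * G r),
      (((k / r : ℝ) : ℂ) * g r + ((m - e : ℝ) : ℂ) * f r) -
        (((k' / r : ℝ) : ℂ) * G r + ((m' - e' : ℝ) : ℂ) * F r)))
    (by positivity) (by positivity) ((hf.sub hF).prodMk (hg.sub hG)) ?_ ?_ hs ht
  · intro r hr
    exact ((h r hr).1.sub (h' r hr).1).prodMk ((h r hr).2.sub (h' r hr).2)
  · intro r hr
    have hA := hbound k r hr
    have hB := hbound (k - k') r hr
    have hFG := hM r hr
    rw [Prod.norm_def]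
    refine max_le ?_ ?_
    -- The unprimed system acts on the difference of the solutions and gives the Grönwall rate; the
    -- differences of the parameters act on `(F, G)` and give the inhomogeneity.
    · have e1 : (((-(k / r) : ℝ) : ℂ) * f r + ((m + e : ℝ) : ℂ) * g r) -
          (((-(k' / r) : ℝ) : ℂ) * F r + ((m' + e' : ℝ) : ℂ) * G r) =
          (((-(k / r) : ℝ) : ℂ) * (f r - F r) + ((m + e : ℝ) : ℂ) * (g r - G r)) +
          (((-((k - k') / r) : ℝ) : ℂ) * F r + ((m - m' + (e - e') : ℝ) : ℂ) * G r) := by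
        push_cast; ring
      rw [e1]
      refine (norm_add_le _ _).trans (add_le_add ?_ ?_)
      · exact norm_linear_le ((abs_neg _).trans_le hA) (abs_add_le _ _)
      · refine (norm_linear_le ((abs_neg _).trans_le hB) (abs_add_le _ _)).trans ?_
        gcongr
    · have e1 : (((k / r : ℝ) : ℂ) * g r + ((m - e : ℝ) : ℂ) * f r) -
          (((k' / r : ℝ) : ℂ) * G r + ((m' - e' : ℝ) : ℂ) * F r) =
          (((k / r : ℝ) : ℂ) * (g r - G r) + ((m - e : ℝ) : ℂ) * (f r - F r)) +
          ((((k - k') / r : ℝ) : ℂ) * G r + ((m - m' - (e - e') : ℝ) : ℂ) * F r) := by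
        push_cast; ring
      rw [e1]
      refine (norm_add_le _ _).trans (add_le_add ?_ ?_)
      · rw [← norm_swap (f r - F r)]
        exact norm_linear_le hA (abs_sub _ _)
      · rw [← norm_swap] at hFG
        refine (norm_linear_le hB (abs_sub _ _)).trans ?_
        gcongr

/-- A solution vanishing at one point vanishes identically. -/
theorem eq_zero {α β : ℝ} (hα : 0 < α) (h : DiracODE m k e (Ioo α β) f g)
    (hf : ContinuousOn f (Icc α β)) (hg : ContinuousOn g (Icc α β)) {s t : ℝ}
    (hs : s ∈ Icc α β) (ht : t ∈ Icc α β) (h0 : (f s, g s) = 0) : (f t, g t) = 0 := by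
  have := norm_sub_le (M := 0) hα h (zero (m := m) (k := k) (e := e)) hf hg continuousOn_const
    continuousOn_const le_rfl (by simp) hs ht
  rw [← norm_le_zero_iff]
  simpa [h0] using this

/-- An absolutely continuous eigenfunction solves the Dirac system classically on every open set
where the potential is constant. -/
theorem of_isAC {m : ℝ} {k : ℤ} {a v : ℝ} {V : ℝ → ℝ} {φ : RadialSpinor} (hφ : IsAC (Ioi 0) φ)
    (heig : radialDirac m k V φ =ᵐ[halfLine] fun r => (a : ℂ) • φ r) (hs : IsOpen s)
    (hs0 : s ⊆ Ioi 0) (hV : ∀ r ∈ s, V r = v) :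
    DiracODE m k (a - v) s (fun r => φ r 0) (fun r => φ r 1) := by
  have hcont : ∀ i, ContinuousOn (fun r => φ r i) s := fun i => (hφ.continuousOn i).mono hs0
  have hdiv : ContinuousOn (fun r : ℝ => ((k / r : ℝ) : ℂ)) s :=
    Complex.continuous_ofReal.comp_continuousOn
      (continuousOn_const.div continuousOn_id fun r hr => (ne_of_gt (hs0 hr)))
  have hdiv' : ContinuousOn (fun r : ℝ => ((-(k / r) : ℝ) : ℂ)) s := 
    hdiv.neg.congr fun r _ => Complex.ofReal_neg _
  rw [Filter.EventuallyEq, halfLine, ae_restrict_iff' measurableSet_Ioi] at heig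
  intro r hr
  constructor
  · refine hasDerivAt_of_absolutelyContinuous hs (fun x y hxy => hφ 0 x y (hxy.trans hs0))
      (G := fun r => ((-(k / r) : ℝ) : ℂ) * φ r 0 + ((m + (a - v) : ℝ) : ℂ) * φ r 1)
      ((hdiv'.mul (hcont 0)).add (continuousOn_const.mul (hcont 1))) ?_ r hr
    filter_upwards [heig] with t ht hts
    have := congrFun (ht (hs0 hts)) 1
    simp only [radialDirac, hV t hts, Matrix.cons_val_one, Matrix.cons_val_fin_one, Pi.smul_apply,
      smul_eq_mul] at this
    push_cast at this ⊢
    linear_combination this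
  · refine hasDerivAt_of_absolutelyContinuous hs (fun x y hxy => hφ 1 x y (hxy.trans hs0))
      (G := fun r => ((k / r : ℝ) : ℂ) * φ r 1 + ((m - (a - v) : ℝ) : ℂ) * φ r 0)
      ((hdiv.mul (hcont 1)).add (continuousOn_const.mul (hcont 0))) ?_ r hr
    filter_upwards [heig] with t ht hts
    have := congrFun (ht (hs0 hts)) 0
    simp only [radialDirac, hV t hts, Matrix.cons_val_zero, Pi.smul_apply,
      smul_eq_mul] at this
    push_cast at this ⊢
    linear_combination -this

/-! ### Global solutions with prescribed value at `1` -/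

/-- The ladder operator raising the angular parameter by one. -/
theorem ladder (h : DiracODE m k e s f g) (hs : s ⊆ Ioi 0) (he : m - e ≠ 0) :
    DiracODE m (k + 1) e s
      (fun r => (((-((2 * k + 1) / (m - e))) : ℝ) : ℂ) * ((r⁻¹ : ℝ) : ℂ) * f r +
        (((m + e) / (m - e) : ℝ) : ℂ) * g r) f := by
  intro r hr
  have hr0 : r ≠ 0 := ne_of_gt (hs hr)
  obtain ⟨h1, h2⟩ := h r hr
  have hrC : (r : ℂ) ≠ 0 := by exact_mod_cast hr0
  have heC : (m : ℂ) - e ≠ 0 := by exact_mod_cast he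
  constructor
  · have h3 := (hasDerivAt_inv hr0).ofReal_comp
    convert! ((h3.const_mul (((-((2 * k + 1) / (m - e))) : ℝ) : ℂ)).mul h1).add
      (h2.const_mul (((m + e) / (m - e) : ℝ) : ℂ)) using 1
    push_cast
    field_simp
    ring
  · convert! h1 using 1
    push_cast
    field_simp
    ring

/-- For `|e| < m` the Dirac system has a global solution on `(0, ∞)` with given value at `1`. -/
theorem exists_solution_nat {m e : ℝ} (he : |e| < m) (n : ℕ) (x y : ℂ) :
    ∃ f g : ℝ → ℂ, DiracODE m n e (Ioi 0) f g ∧ f 1 = x ∧ g 1 = y := by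
  obtain ⟨he1, he2⟩ := abs_lt.1 he
  have hsub : m - e ≠ 0 := by linarith
  have hadd : m + e ≠ 0 := by linarith
  induction n generalizing x y with
  | zero =>
    set κ := Real.sqrt ((m + e) * (m - e)) with hκ
    have hκ0 : κ ≠ 0 := (Real.sqrt_pos.2 (mul_pos (by linarith) (by linarith))).ne'
    have hκ2 : κ * κ = (m + e) * (m - e) :=
      Real.mul_self_sqrt (mul_pos (by linarith) (by linarith)).le
    have hκC : (κ : ℂ) ≠ 0 := by exact_mod_cast hκ0
    have hκ2C : (κ : ℂ) * κ = (m + e) * (m - e) := by exact_mod_cast hκ2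
    refine ⟨fun r => ((Real.cosh (κ * (r - 1)) : ℝ) : ℂ) * x +
      (((m + e) / κ * Real.sinh (κ * (r - 1)) : ℝ) : ℂ) * y,
      fun r => ((Real.cosh (κ * (r - 1)) : ℝ) : ℂ) * y +
      (((m - e) / κ * Real.sinh (κ * (r - 1)) : ℝ) : ℂ) * x, ?_, by simp, by simp⟩
    intro r _
    have h0 : HasDerivAt (fun r : ℝ => κ * (r - 1)) κ r := by
      simpa using ((hasDerivAt_id r).sub_const 1).const_mul κ
    have hc := h0.cosh.ofReal_comp
    have hs := fun c : ℝ => (h0.sinh.const_mul c).ofReal_comp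
    constructor
    · convert! (hc.mul_const x).add ((hs ((m + e) / κ)).mul_const y) using 1
      push_cast
      field_simp
      linear_combination -(x * Complex.sinh (κ * (r - 1))) * hκ2C
    · convert! (hc.mul_const y).add ((hs ((m - e) / κ)).mul_const x) using 1
      push_cast
      field_simp
      linear_combination -(y * Complex.sinh (κ * (r - 1))) * hκ2C
  | succ n ih =>
    have heC : (m : ℂ) - e ≠ 0 := by exact_mod_cast hsub
    have haC : (m : ℂ) + e ≠ 0 := by exact_mod_cast hadd
    -- The new second component is the old `f`, so `f 1 = y`; the value of `g 1` solves the ladder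
    -- formula at `r = 1` for the new first component `x`.
    obtain ⟨f, g, hfg, hf, hg⟩ := ih y (((m - e) * x + (2 * n + 1) * y) / (m + e))
    refine ⟨_, _, by simpa using hfg.ladder subset_rfl hsub, ?_, hf⟩
    simp only [hf, hg]
    push_cast
    field_simp
    ring

theorem exists_solution {m e : ℝ} (he : |e| < m) (k : ℤ) (x y : ℂ) :
    ∃ f g : ℝ → ℂ, DiracODE m k e (Ioi 0) f g ∧ f 1 = x ∧ g 1 = y := by
  obtain ⟨n, rfl | rfl⟩ := k.eq_nat_or_neg
  · simpa using exists_solution_nat he n x y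
  · obtain ⟨f, g, h, hf, hg⟩ := exists_solution_nat (e := -e) (by simpa using he) n y x
    exact ⟨g, f, by simpa using h.swap, hg, hf⟩

/-! ### The monotone quantity `Re (f ḡ)` -/

/-- The quantity `Re (f ḡ)` of a spinor `(f, g)`. -/
def crossTerm (f g : ℝ → ℂ) (r : ℝ) : ℝ := (f r).re * (g r).re + (f r).im * (g r).im

theorem abs_crossTerm_le (f g : ℝ → ℂ) (r : ℝ) :
    |crossTerm f g r| ≤ ‖f r‖ ^ 2 + ‖g r‖ ^ 2 := by
  rw [Complex.sq_norm, Complex.sq_norm, Complex.normSq_apply, Complex.normSq_apply, crossTerm,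
    abs_le]
  constructor <;> nlinarith [sq_nonneg ((f r).re + (g r).re), sq_nonneg ((f r).im + (g r).im),
    sq_nonneg ((f r).re - (g r).re), sq_nonneg ((f r).im - (g r).im),
    sq_nonneg (f r).re, sq_nonneg (f r).im, sq_nonneg (g r).re, sq_nonneg (g r).im]

theorem crossTerm_swap (f g : ℝ → ℂ) (r : ℝ) : crossTerm g f r = crossTerm f g r := by
  simp only [crossTerm]; ring

/-- The centrifugal term enters the two equations with opposite signs and drops out of the product.
-/
theorem hasDerivAt_crossTerm (h : DiracODE m k e s f g) {r : ℝ} (hr : r ∈ s) :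
    HasDerivAt (crossTerm f g) ((m + e) * ‖g r‖ ^ 2 + (m - e) * ‖f r‖ ^ 2) r := by
  obtain ⟨h1, h2⟩ := h r hr
  have f1 : HasDerivAt (fun r => (f r).re) _ r := (Complex.reCLM.hasFDerivAt.comp_hasDerivAt r h1)
  have f2 : HasDerivAt (fun r => (f r).im) _ r := (Complex.imCLM.hasFDerivAt.comp_hasDerivAt r h1)
  have g1 : HasDerivAt (fun r => (g r).re) _ r := (Complex.reCLM.hasFDerivAt.comp_hasDerivAt r h2)
  have g2 : HasDerivAt (fun r => (g r).im) _ r := (Complex.imCLM.hasFDerivAt.comp_hasDerivAt r h2)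
  convert! (f1.mul g1).add (f2.mul g2) using 1
  simp only [Complex.reCLM_apply, Complex.imCLM_apply, Complex.add_re, Complex.add_im,
    Complex.re_ofReal_mul, Complex.im_ofReal_mul, Complex.sq_norm, Complex.normSq_apply]
  ring

theorem hasDerivAt_normSq_fst (h : DiracODE m k e s f g) {r : ℝ} (hr : r ∈ s) :
    HasDerivAt (fun r => ‖f r‖ ^ 2)
      (-(2 * k / r) * ‖f r‖ ^ 2 + 2 * (m + e) * crossTerm f g r) r := by
  obtain ⟨h1, h2⟩ := h r hr
  have f1 : HasDerivAt (fun r => (f r).re) _ r := (Complex.reCLM.hasFDerivAt.comp_hasDerivAt r h1)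
  have f2 : HasDerivAt (fun r => (f r).im) _ r := (Complex.imCLM.hasFDerivAt.comp_hasDerivAt r h1)
  have : (fun r => ‖f r‖ ^ 2) = fun r => (f r).re * (f r).re + (f r).im * (f r).im := by
    funext r
    rw [Complex.sq_norm, Complex.normSq_apply]
  rw [this]
  convert! (f1.mul f1).add (f2.mul f2) using 1
  simp only [Complex.reCLM_apply, Complex.imCLM_apply, Complex.add_re, Complex.add_im,
    Complex.re_ofReal_mul, Complex.im_ofReal_mul, Complex.sq_norm, Complex.normSq_apply, crossTerm]
  ring

theorem monotoneOn_crossTerm (h : DiracODE m k e s f g) (he : |e| < m) (hs : Convex ℝ s) :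
    MonotoneOn (crossTerm f g) s := by
  obtain ⟨he1, he2⟩ := abs_lt.1 he
  have h1 := sub_pos.2 he2
  have h2 : 0 < m + e := by linarith
  refine monotoneOn_of_deriv_nonneg hs
    (fun r hr => (h.hasDerivAt_crossTerm hr).continuousAt.continuousWithinAt)
    (fun r hr =>
      (h.hasDerivAt_crossTerm (interior_subset hr)).differentiableAt.differentiableWithinAt)
    fun r hr => ?_
  rw [(h.hasDerivAt_crossTerm (interior_subset hr)).deriv]
  positivity

/-- If `Re (f ḡ)` is negative at `r₀`, it is negative on all of `(0, r₀]` by monotonicity. For `k ≥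
1` this makes `r |f|²` decreasing, so `|f|² ≥ c / r` with `c > 0`, which is not integrable at `0`.
-/
theorem crossTerm_nonneg_of_one_le (h : DiracODE m k e s f g) (he : |e| < m) (hk : 1 ≤ k)
    {b : ℝ} (hb : Ioo 0 b ⊆ s) (hf : IntegrableOn (fun r => ‖f r‖ ^ 2) (Ioo 0 b)) {r₀ : ℝ}
    (hr₀ : r₀ ∈ Ioo 0 b) : 0 ≤ crossTerm f g r₀ := by
  by_contra! hneg
  replace h := h.mono hb
  obtain ⟨he1, he2⟩ := abs_lt.1 he
  have hsub : Ioc 0 r₀ ⊆ Ioo 0 b := fun t ht => ⟨ht.1, ht.2.trans_lt hr₀.2⟩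
  have hder : ∀ r ∈ Ioc 0 r₀, HasDerivAt (fun r => r * ‖f r‖ ^ 2)
      ((1 - 2 * k) * ‖f r‖ ^ 2 + 2 * (m + e) * (r * crossTerm f g r)) r := by
    intro r hr
    have hr0 : r ≠ 0 := hr.1.ne'
    convert! (hasDerivAt_id r).mul (h.hasDerivAt_normSq_fst (hsub hr)) using 1
    simp only [id]
    field_simp
    ring
  have hanti : AntitoneOn (fun r => r * ‖f r‖ ^ 2) (Ioc 0 r₀) := by
    refine antitoneOn_of_deriv_nonpos (convex_Ioc 0 r₀)
      (fun r hr => (hder r hr).continuousAt.continuousWithinAt)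
      (fun r hr => (hder r (interior_subset hr)).differentiableAt.differentiableWithinAt)
      fun r hr => ?_
    have hr' := interior_subset hr
    rw [(hder r hr').deriv]
    have h1 : crossTerm f g r ≤ crossTerm f g r₀ :=
      h.monotoneOn_crossTerm he (convex_Ioo 0 b) (hsub hr') hr₀ hr'.2
    have h2 : r * crossTerm f g r ≤ 0 := mul_nonpos_of_nonneg_of_nonpos hr'.1.le (by linarith)
    have h3 : 0 < m + e := by linarith
    nlinarith [sq_nonneg ‖f r‖]
  have hf0 : 0 < r₀ * ‖f r₀‖ ^ 2 := by
    have : f r₀ ≠ 0 := fun h0 => by simp [crossTerm, h0] at hneg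
    have := hr₀.1
    positivity
  have hint : IntegrableOn (fun r : ℝ => r⁻¹) (Ioc 0 r₀) := by
    refine ((hf.mono_set hsub).const_mul (r₀ * ‖f r₀‖ ^ 2)⁻¹).mono'
      measurable_inv.aestronglyMeasurable ?_
    refine (ae_restrict_iff' measurableSet_Ioc).2 (.of_forall fun r hr => ?_)
    have h1 := hanti hr ⟨hr₀.1, le_rfl⟩ hr.2
    have hr0 := hr.1
    simp only at h1
    rw [Real.norm_of_nonneg (by positivity), inv_mul_eq_div, le_div_iff₀ hf0, inv_mul_eq_div,
      div_le_iff₀ hr0]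
    linarith
  have := (intervalIntegrable_iff_integrableOn_Ioc_of_le hr₀.1.le).2 hint
  rw [intervalIntegrable_inv_iff] at this
  rcases this with h0 | h0
  · exact hr₀.1.ne h0
  · exact h0 left_mem_uIcc

/-- A solution that is square integrable near `0` satisfies `Re (f ḡ) ≥ 0`. -/
theorem crossTerm_nonneg {k : ℤ} (h : DiracODE m k e s f g) (he : |e| < m) (hk : k ≠ 0)
    {b : ℝ} (hb : Ioo 0 b ⊆ s) (hf : IntegrableOn (fun r => ‖f r‖ ^ 2) (Ioo 0 b))
    (hg : IntegrableOn (fun r => ‖g r‖ ^ 2) (Ioo 0 b)) {r₀ : ℝ}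
    (hr₀ : r₀ ∈ Ioo 0 b) : 0 ≤ crossTerm f g r₀ := by
  rcases lt_or_gt_of_ne hk with hk | hk
  · rw [← crossTerm_swap]
    refine h.swap.crossTerm_nonneg_of_one_le (by simpa using he) ?_ hb hg hr₀
    have : (k : ℝ) ≤ -1 := by exact_mod_cast Int.le_sub_one_of_lt hk
    linarith
  · exact h.crossTerm_nonneg_of_one_le he (by exact_mod_cast hk) hb hf hr₀

/-- A solution that is square integrable near infinity satisfies `Re (f ḡ) ≤ 0`. -/
theorem crossTerm_nonpos {b : ℝ} (h : DiracODE m k e (Ioi b) f g) (he : |e| < m)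
    (hf : IntegrableOn (fun r => ‖f r‖ ^ 2) (Ioi b))
    (hg : IntegrableOn (fun r => ‖g r‖ ^ 2) (Ioi b)) {r₀ : ℝ} (hr₀ : b < r₀) :
    crossTerm f g r₀ ≤ 0 := by
  by_contra! hpos
  -- By monotonicity `|f|² + |g|²` dominates a positive constant on a half-line of infinite measure.
  have hint : IntegrableOn (fun _ : ℝ => crossTerm f g r₀) (Ioi r₀) := by
    refine ((hf.add hg).mono_set (Ioi_subset_Ioi hr₀.le)).mono' aestronglyMeasurable_const ?_
    refine (ae_restrict_iff' measurableSet_Ioi).2 (.of_forall fun r hr => ?_)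
    rw [Real.norm_of_nonneg hpos.le]
    have h1 := h.monotoneOn_crossTerm he (convex_Ioi b) hr₀ (hr₀.trans hr) (le_of_lt hr)
    exact h1.trans ((le_abs_self _).trans (abs_crossTerm_le f g r))
  rw [integrableOn_const_iff] at hint
  simp [hpos.ne'] at hint

/-- The derivative of `Re (f ḡ)` is at least `(m - |e|) (|f|² + |g|²)`; the sign conditions make the
right side bounded as `α → 0` or `β → ∞`. -/
theorem integral_sq_le (h : DiracODE m k e (Ioi 0) f g) (he : |e| < m) {α β : ℝ} (hα : 0 < α)
    (hαβ : α ≤ β) :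
    ∫ r in α..β, (‖f r‖ ^ 2 + ‖g r‖ ^ 2) ≤
      (crossTerm f g β - crossTerm f g α) / (m - |e|) := by
  have hsub : uIcc α β ⊆ Ioi 0 := by
    rw [uIcc_of_le hαβ]
    exact fun t ht => hα.trans_le ht.1
  have hcf : ContinuousOn (fun r => ‖f r‖ ^ 2) (uIcc α β) :=
    (h.continuousOn_fst.mono hsub).norm.pow 2
  have hcg : ContinuousOn (fun r => ‖g r‖ ^ 2) (uIcc α β) :=
    (h.continuousOn_snd.mono hsub).norm.pow 2
  have hint : IntervalIntegrable (fun r => (m + e) * ‖g r‖ ^ 2 + (m - e) * ‖f r‖ ^ 2)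
      volume α β :=
    ((continuousOn_const.mul hcg).add (continuousOn_const.mul hcf)).intervalIntegrable
  rw [le_div_iff₀ (by linarith), ← intervalIntegral.integral_eq_sub_of_hasDerivAt
    (fun r hr => h.hasDerivAt_crossTerm (hsub hr)) hint, ← intervalIntegral.integral_mul_const]
  refine intervalIntegral.integral_mono_on hαβ
    ((hcf.add hcg).mul continuousOn_const).intervalIntegrable hint fun r _ => ?_
  have h1 := le_abs_self e
  have h2 := neg_le_abs e
  nlinarith [sq_nonneg ‖f r‖, sq_nonneg ‖g r‖]

theorem integrableOn_sq_add_Ioc (h : DiracODE m k e (Ioi 0) f g) {α β : ℝ} (hα : 0 < α) :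
    IntegrableOn (fun r => ‖f r‖ ^ 2 + ‖g r‖ ^ 2) (Ioc α β) := by
  have hsub : Icc α β ⊆ Ioi 0 := fun t ht => hα.trans_le ht.1
  exact ((((h.continuousOn_fst.mono hsub).norm.pow 2).add
    ((h.continuousOn_snd.mono hsub).norm.pow 2)).integrableOn_Icc).mono_set Ioc_subset_Icc_self

theorem norm_sq_add (f g : ℝ → ℂ) (r : ℝ) :
    ‖‖f r‖ ^ 2 + ‖g r‖ ^ 2‖ = ‖f r‖ ^ 2 + ‖g r‖ ^ 2 :=
  Real.norm_of_nonneg (by positivity)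

/-- A solution with `Re (f ḡ) ≥ 0` near `0` is square integrable near `0`. -/
theorem integrableOn_Ioc_zero (h : DiracODE m k e (Ioi 0) f g) (he : |e| < m) {b : ℝ}
    (hb : 0 < b) (hp : ∀ r ∈ Ioo 0 b, 0 ≤ crossTerm f g r) :
    IntegrableOn (fun r => ‖f r‖ ^ 2 + ‖g r‖ ^ 2) (Ioc 0 b) := by
  -- The shift by `2` keeps every term strictly below `b`, where the sign is known.
  have hu : Tendsto (fun n : ℕ => b / (n + 2)) atTop (𝓝 0) :=
    tendsto_const_nhds.div_atTop
      (tendsto_atTop_add_const_right _ _ tendsto_natCast_atTop_atTop)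
  have hmem : ∀ n : ℕ, b / (n + 2) ∈ Ioo 0 b := fun n =>
    ⟨by positivity, div_lt_self hb (by linarith [n.cast_nonneg (α := ℝ)])⟩
  refine integrableOn_Ioc_of_intervalIntegral_norm_bounded_left (l := atTop)
    (I := crossTerm f g b / (m - |e|)) (fun n => h.integrableOn_sq_add_Ioc (hmem n).1) hu
    (.of_forall fun n => ?_)
  simp only [norm_sq_add]
  rw [← intervalIntegral.integral_of_le (hmem n).2.le]
  refine (h.integral_sq_le he (hmem n).1 (hmem n).2.le).trans ?_
  have := sub_pos.2 he
  have := hp _ (hmem n)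
  gcongr
  linarith

/-- A solution with `Re (f ḡ) ≤ 0` near infinity is square integrable near infinity. -/
theorem integrableOn_Ioi (h : DiracODE m k e (Ioi 0) f g) (he : |e| < m) {b : ℝ}
    (hb : 0 < b) (hp : ∀ r ∈ Ioi b, crossTerm f g r ≤ 0) :
    IntegrableOn (fun r => ‖f r‖ ^ 2 + ‖g r‖ ^ 2) (Ioi b) := by
  refine integrableOn_Ioi_of_intervalIntegral_norm_bounded (l := atTop) (b := id)
    (-crossTerm f g b / (m - |e|)) b (fun n => h.integrableOn_sq_add_Ioc hb) tendsto_id ?_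
  filter_upwards [eventually_gt_atTop b] with t ht
  simp only [norm_sq_add, id]
  refine (h.integral_sq_le he hb ht.le).trans ?_
  have := sub_pos.2 he
  have := hp _ ht
  gcongr
  linarith

end DiracODE

/-! ### Eigenfunctions of the shrinking potential -/

/-- `(f, g)` is an eigenfunction of the operator with potential `shortRange μ ε` and energy `a`,
normalized at `1 - ε`. -/
structure IsNormalizedMode (m k μ ε a : ℝ) (f g : ℝ → ℂ) : Prop where
  left : DiracODE m k a (Ioo 0 (1 - ε)) f g
  mid : DiracODE m k (a - μ / (2 * ε)) (Ioo (1 - ε) (1 + ε)) f g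
  right : DiracODE m k a (Ioi (1 + ε)) f g
  cont_fst : ContinuousOn f (Ioi 0)
  cont_snd : ContinuousOn g (Ioi 0)
  int_fst : IntegrableOn (fun r => ‖f r‖ ^ 2) (Ioi 0)
  int_snd : IntegrableOn (fun r => ‖g r‖ ^ 2) (Ioi 0)
  norm_eq : ‖(f (1 - ε), g (1 - ε))‖ = 1

theorem exists_isNormalizedMode {m : ℝ} {k : ℤ} {μ ε a : ℝ} (hε : 0 < ε) (hε1 : ε < 1)
    (h : (a : ℂ) ∈ shortRangePointSpectrum m k μ ε) :
    ∃ f g : ℝ → ℂ, IsNormalizedMode m k μ ε a f g := by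
  obtain ⟨φ, ⟨hL2, -, hAC⟩, hne, heig⟩ := h
  have hleft : DiracODE m k a (Ioo 0 (1 - ε)) (fun r => φ r 0) (fun r => φ r 1) := by
    simpa using DiracODE.of_isAC (v := 0) hAC heig isOpen_Ioo (fun r hr => hr.1)
      fun r hr => indicator_of_notMem (fun h => by linarith [h.1, hr.2]) _
  have hmid : DiracODE m k (a - μ / (2 * ε)) (Ioo (1 - ε) (1 + ε))
      (fun r => φ r 0) (fun r => φ r 1) :=
    DiracODE.of_isAC hAC heig isOpen_Ioo (fun r hr => lt_trans (by linarith) hr.1)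
      fun r hr => indicator_of_mem hr _
  have hright : DiracODE m k a (Ioi (1 + ε)) (fun r => φ r 0) (fun r => φ r 1) := by
    simpa using DiracODE.of_isAC (v := 0) hAC heig isOpen_Ioi
      (fun r hr => lt_trans (by linarith) (mem_Ioi.1 hr))
      fun r hr => indicator_of_notMem (fun h => by linarith [h.2, mem_Ioi.1 hr]) _
  have hc := hAC.continuousOn
  have hcI : ∀ i x y, 0 < x → ContinuousOn (fun r => φ r i) (Icc x y) := fun i x y hx =>
    (hc i).mono fun t ht => hx.trans_le ht.1
  have hsq : ∀ i, IntegrableOn (fun r => ‖φ r i‖ ^ 2) (Ioi 0) := fun i =>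
    (memLp_two_iff_integrable_sq_norm (hL2 i).1).1 (hL2 i)
  -- A zero at `1 - ε` would spread by uniqueness across the three intervals, making `φ` vanish on
  -- `(0, ∞)`.
  have hval : (φ (1 - ε) 0, φ (1 - ε) 1) ≠ 0 := by
    intro h0
    have h1 : (φ (1 + ε) 0, φ (1 + ε) 1) = 0 :=
      hmid.eq_zero (by linarith) (hcI 0 _ _ (by linarith)) (hcI 1 _ _ (by linarith))
        (left_mem_Icc.2 (by linarith)) (right_mem_Icc.2 (by linarith)) h0
    have hall : ∀ r ∈ Ioi (0 : ℝ), (φ r 0, φ r 1) = 0 := by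
      intro r hr
      rw [mem_Ioi] at hr
      rcases le_total r (1 - ε) with hr1 | hr1
      · exact (hleft.mono (Ioo_subset_Ioo_left hr.le)).eq_zero hr (hcI 0 _ _ hr) (hcI 1 _ _ hr)
          (right_mem_Icc.2 hr1) (left_mem_Icc.2 hr1) h0
      rcases le_total r (1 + ε) with hr2 | hr2
      · exact hmid.eq_zero (by linarith) (hcI 0 _ _ (by linarith)) (hcI 1 _ _ (by linarith))
          (left_mem_Icc.2 (by linarith)) ⟨hr1, hr2⟩ h0
      · exact (hright.mono (t := Ioo (1 + ε) r) Ioo_subset_Ioi_self).eq_zero (by linarith)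
          (hcI 0 _ _ (by linarith)) (hcI 1 _ _ (by linarith))
          (left_mem_Icc.2 hr2) (right_mem_Icc.2 hr2) h1
    refine hne ((ae_restrict_iff' measurableSet_Ioi).2 (.of_forall fun r hr => ?_))
    have := Prod.mk_eq_zero.1 (hall r hr)
    funext i
    fin_cases i
    · exact this.1
    · exact this.2
  set N : ℂ := ((‖(φ (1 - ε) 0, φ (1 - ε) 1)‖⁻¹ : ℝ) : ℂ) with hN
  refine ⟨fun r => N * φ r 0, fun r => N * φ r 1, hleft.const_mul N, hmid.const_mul N,
    hright.const_mul N, continuousOn_const.mul (hc 0), continuousOn_const.mul (hc 1), ?_, ?_, ?_⟩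
  · simp only [norm_mul, mul_pow]
    exact (hsq 0).const_mul (‖N‖ ^ 2)
  · simp only [norm_mul, mul_pow]
    exact (hsq 1).const_mul (‖N‖ ^ 2)
  · have : (N * φ (1 - ε) 0, N * φ (1 - ε) 1) = N • (φ (1 - ε) 0, φ (1 - ε) 1) := rfl
    rw [this, norm_smul, hN, Complex.norm_real, norm_inv, norm_norm,
      inv_mul_cancel₀ (norm_ne_zero_iff.2 hval)]

/-- The constant potential `v` without mass and centrifugal term rotates the spinor. -/
theorem DiracODE.rotation (v c : ℝ) (x y : ℂ) (s : Set ℝ) :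
    DiracODE 0 0 (-v) s
      (fun r => ((Real.cos (v * (r - c)) : ℝ) : ℂ) * x - ((Real.sin (v * (r - c)) : ℝ) : ℂ) * y)
      (fun r => ((Real.sin (v * (r - c)) : ℝ) : ℂ) * x +
        ((Real.cos (v * (r - c)) : ℝ) : ℂ) * y) := by
  intro r _
  have h0 : HasDerivAt (fun r : ℝ => v * (r - c)) v r := by
    simpa using ((hasDerivAt_id r).sub_const c).const_mul v
  have hc := h0.cos.ofReal_comp
  have hs := h0.sin.ofReal_comp
  constructor
  · convert! (hc.mul_const x).sub (hs.mul_const y) using 1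
    push_cast
    ring
  · convert! (hs.mul_const x).add (hc.mul_const y) using 1
    push_cast
    ring

namespace IsNormalizedMode

variable {m k μ ε a : ℝ} {f g : ℝ → ℂ}

/-- Across the support of the potential a mode is rotated by the angle `μ`, up to `O(ε)`. -/
theorem norm_sub_rotation_le (h : IsNormalizedMode m k μ ε a f g) (hε : 0 < ε)
    (hε2 : ε ≤ 1 / 2) (ha : |a| ≤ m) :
    ‖(f (1 + ε) - (((Real.cos μ : ℝ) : ℂ) * f (1 - ε) - ((Real.sin μ : ℝ) : ℂ) * g (1 - ε)),
      g (1 + ε) - (((Real.sin μ : ℝ) : ℂ) * f (1 - ε) + ((Real.cos μ : ℝ) : ℂ) * g (1 - ε)))‖ ≤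
      8 * (|k| + m) * Real.exp (2 * (|k| + m) + |μ|) * ε := by
  have hm : 0 ≤ m := (abs_nonneg a).trans ha
  have hα : 0 < 1 - ε := by linarith
  set v := μ / (2 * ε) with hv
  have hvμ : v * (1 + ε - (1 - ε)) = μ := by
    rw [hv]; field_simp; ring
  have hx : ‖f (1 - ε)‖ ≤ 1 := (norm_fst_le (f (1 - ε), g (1 - ε))).trans_eq h.norm_eq
  have hy : ‖g (1 - ε)‖ ≤ 1 := (norm_snd_le (f (1 - ε), g (1 - ε))).trans_eq h.norm_eq
  have hrot := DiracODE.rotation v (1 - ε) (f (1 - ε)) (g (1 - ε)) (Ioi 0)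
  have hsub : Icc (1 - ε) (1 + ε) ⊆ Ioi 0 := fun t ht => hα.trans_le ht.1
  -- The large `v` cancels in the difference of energies, which is `a`. It survives only in the
  -- Grönwall rate, where the length `2ε` turns it into `|μ|`. In the sup norm a rotated unit vector
  -- has norm at most `2`.
  have key := h.mid.norm_sub_le (M := 2) hα
    (hrot.mono (Ioo_subset_Icc_self.trans hsub))
    (h.cont_fst.mono hsub) (h.cont_snd.mono hsub) (hrot.continuousOn_fst.mono hsub)
    (hrot.continuousOn_snd.mono hsub) zero_le_two ?_
    (left_mem_Icc.2 (by linarith)) (right_mem_Icc.2 (by linarith))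
  · simp only [hvμ, sub_self, mul_zero, Real.cos_zero, Real.sin_zero, Complex.ofReal_one,
      Complex.ofReal_zero, one_mul, zero_mul, sub_zero, zero_add, Prod.mk_zero_zero,
      norm_zero] at key
    refine key.trans ?_
    have h1 : |k| / (1 - ε) ≤ 2 * |k| := by
      rw [div_le_iff₀ hα]
      nlinarith [abs_nonneg k]
    have h2 : a - v - -v = a := by ring
    have h3 : (|k| / (1 - ε) + (|m| + |a - v|)) * (1 + ε - (1 - ε)) ≤ 2 * (|k| + m) + |μ| := by
      have h4 : |a - v| * (2 * ε) ≤ |a| * (2 * ε) + |μ| := by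
        have h5 : |v| * (2 * ε) = |μ| := by
          rw [hv, abs_div, abs_of_pos (by positivity : 0 < 2 * ε)]
          field_simp
        have := abs_sub a v
        rw [← h5, ← add_mul]
        gcongr
      have h6 : |k| / (1 - ε) * (2 * ε) ≤ 2 * |k| * (2 * ε) := by gcongr
      rw [abs_of_nonneg hm]
      nlinarith [abs_nonneg k]
    rw [h2, abs_of_nonneg hm]
    rw [abs_of_nonneg hm] at h3
    have h7 : (|k| / (1 - ε) + (m + |a|)) * 2 * (1 + ε - (1 - ε)) ≤ 8 * (|k| + m) * ε := by
      have : (|k| / (1 - ε) + (m + |a|)) * (4 * ε) ≤ (2 * |k| + (m + m)) * (4 * ε) := by gcongr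
      linarith
    calc _ ≤ 8 * (|k| + m) * ε * Real.exp (2 * (|k| + m) + |μ|) := by gcongr
      _ = _ := by ring
  · intro t _
    have hb : ∀ (p q : ℝ) (z w : ℂ), |p| ≤ 1 → |q| ≤ 1 → ‖z‖ ≤ 1 → ‖w‖ ≤ 1 →
        ‖(p : ℂ) * z‖ + ‖(q : ℂ) * w‖ ≤ 2 := by
      intro p q z w hp hq hz hw
      simp only [norm_mul, Complex.norm_real, Real.norm_eq_abs]
      nlinarith [mul_le_one₀ hp (norm_nonneg z) hz, mul_le_one₀ hq (norm_nonneg w) hw]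
    refine max_le ((_root_.norm_sub_le _ _).trans (hb _ _ _ _ ?_ ?_ hx hy))
      ((norm_add_le _ _).trans (hb _ _ _ _ ?_ ?_ hx hy)) <;>
    first | exact Real.abs_cos_le_one _ | exact Real.abs_sin_le_one _

theorem crossTerm_nonneg {k : ℤ} (h : IsNormalizedMode m k μ ε a f g) (ha : |a| < m)
    (hk : k ≠ 0) {r : ℝ} (hr : 0 < r) (hr1 : r < 1 - ε) : 0 ≤ DiracODE.crossTerm f g r :=
  h.left.crossTerm_nonneg ha hk subset_rfl (h.int_fst.mono_set Ioo_subset_Ioi_self)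
    (h.int_snd.mono_set Ioo_subset_Ioi_self) ⟨hr, hr1⟩

theorem crossTerm_nonpos (h : IsNormalizedMode m k μ ε a f g) (hε : 0 < ε) (ha : |a| < m)
    {r : ℝ} (hr : 1 + ε < r) : DiracODE.crossTerm f g r ≤ 0 :=
  h.right.crossTerm_nonpos ha (h.int_fst.mono_set (Ioi_subset_Ioi (by linarith)))
    (h.int_snd.mono_set (Ioi_subset_Ioi (by linarith))) hr

end IsNormalizedMode

/-! ### Convergence of solutions -/

/-- Solutions whose energies and whose values at points `c i → 1` converge, converge pointwise. -/
theorem DiracODE.tendsto {ι : Type*} {l : Filter ι} {m k e : ℝ} {f g : ℝ → ℂ}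
    {F G : ι → ℝ → ℂ} {E c : ι → ℝ} (h : DiracODE m k e (Ioi 0) f g) {r : ℝ} (hr : 0 < r)
    (hE : Tendsto E l (𝓝 e)) (hc : Tendsto c l (𝓝 1))
    (hF : ∀ᶠ i in l, DiracODE m k (E i) (Ioo (min r (c i)) (max r (c i))) (F i) (G i))
    (hFc : ∀ᶠ i in l, ContinuousOn (F i) (Ioi 0))
    (hGc : ∀ᶠ i in l, ContinuousOn (G i) (Ioi 0))
    (hval : Tendsto (fun i => (F i (c i), G i (c i))) l (𝓝 (f 1, g 1))) :
    Tendsto (fun i => (F i r, G i r)) l (𝓝 (f r, g r)) := by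
  -- `[α, β]` is a fixed compact interval containing `r` and eventually `c i`, so the constants are
  -- uniform in `i`.
  set α := min r (1 / 2) with hα
  set β := max r 2 with hβ
  have hα0 : 0 < α := lt_min hr (by norm_num)
  have hαβ : 0 ≤ β - α := by
    have := min_le_left r (1 / 2)
    have := le_max_left r 2
    linarith
  have hsub : Icc α β ⊆ Ioi 0 := fun t ht => hα0.trans_le ht.1
  obtain ⟨M, hM⟩ := isCompact_Icc.exists_bound_of_continuousOn
    ((h.continuousOn_fst.mono hsub).prodMk (h.continuousOn_snd.mono hsub))
  have hM0 : 0 ≤ M := (norm_nonneg _).trans (hM r ⟨min_le_left _ _, le_max_left _ _⟩)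
  have hd : Tendsto (fun i => (F i (c i) - f (c i), G i (c i) - g (c i))) l (𝓝 0) := by
    have h1 : ContinuousAt (fun t => (f t, g t)) 1 :=
      (h 1 (mem_Ioi.2 one_pos)).1.continuousAt.prodMk (h 1 (mem_Ioi.2 one_pos)).2.continuousAt
    simpa using hval.sub (h1.tendsto.comp hc)
  have hbound : Tendsto (fun i => (‖(F i (c i) - f (c i), G i (c i) - g (c i))‖ +
      |E i - e| * M * (β - α)) * Real.exp ((|k| / α + (|m| + (|e| + 1))) * (β - α))) l (𝓝 0) := by
    have h1 : Tendsto (fun i => |E i - e|) l (𝓝 0) := by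
      simpa using (hE.sub_const e).abs
    simpa using (hd.norm.add ((h1.mul_const M).mul_const (β - α))).mul_const
      (Real.exp ((|k| / α + (|m| + (|e| + 1))) * (β - α)))
  rw [tendsto_iff_norm_sub_tendsto_zero]
  refine squeeze_zero' (.of_forall fun i => norm_nonneg _) ?_ hbound
  have hEb : ∀ᶠ i in l, |E i| < |e| + 1 := hE.abs.eventually_lt_const (by linarith)
  filter_upwards [hF, hFc, hGc, hEb, hc.eventually (Icc_mem_nhds (by norm_num : (1 / 2 : ℝ) < 1)
    (by norm_num : (1 : ℝ) < 2))] with i hFi hFci hGci hEi hci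
  set α' := min r (c i) with hα'
  set β' := max r (c i) with hβ'
  have hαα' : α ≤ α' := min_le_min_left r hci.1
  have hββ' : β' ≤ β := max_le_max_left r hci.2
  have hα'0 : 0 < α' := hα0.trans_le hαα'
  have hIcc : Icc α' β' ⊆ Icc α β := Icc_subset_Icc hαα' hββ'
  have hI := hIcc.trans hsub
  have key := hFi.norm_sub_le hα'0 (h.mono (Ioo_subset_Icc_self.trans hI)) (hFci.mono hI)
    (hGci.mono hI) (h.continuousOn_fst.mono hI) (h.continuousOn_snd.mono hI) hM0
    (fun t ht => hM t (hIcc (Ioo_subset_Icc_self ht)))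
    (s := c i) (t := r) ⟨min_le_right _ _, le_max_right _ _⟩ ⟨min_le_left _ _, le_max_left _ _⟩
  simp only [sub_self, abs_zero, zero_div, zero_add] at key
  refine key.trans ?_
  have hαβ' : 0 ≤ β' - α' := sub_nonneg.2 ((min_le_left _ _).trans (le_max_left _ _))
  gcongr

theorem continuous_crossTerm_value :
    Continuous fun p : ℂ × ℂ => p.1.re * p.2.re + p.1.im * p.2.im := by
  fun_prop

/-! ### Gluing an eigenfunction of the shell operator -/

namespace DiracODE

variable {m k e : ℝ} {s : Set ℝ} {f g : ℝ → ℂ}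

theorem congr (h : DiracODE m k e s f g) (hs : IsOpen s) {f' g' : ℝ → ℂ} (hf : EqOn f' f s)
    (hg : EqOn g' g s) : DiracODE m k e s f' g' := by
  intro r hr
  rw [hf hr, hg hr]
  exact ⟨(h r hr).1.congr_of_eventuallyEq (hf.eventuallyEq_of_mem (hs.mem_nhds hr)),
    (h r hr).2.congr_of_eventuallyEq (hg.eventuallyEq_of_mem (hs.mem_nhds hr))⟩

/-- The derivative is bounded on compact intervals, so `f` is Lipschitz there; `swap` gives the same
for `g`. -/
theorem absolutelyContinuous_fst (h : DiracODE m k e s f g) (hs : s ⊆ Ioi 0) {x y : ℝ}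
    (hxy : uIcc x y ⊆ s) : AbsolutelyContinuousOnInterval f x y := by
  have hdiv : ContinuousOn (fun r : ℝ => ((-(k / r) : ℝ) : ℂ)) s :=
    Complex.continuous_ofReal.comp_continuousOn
      (continuousOn_const.div continuousOn_id fun r hr => (ne_of_gt (hs hr))).neg
  obtain ⟨C, hC⟩ := isCompact_uIcc.exists_bound_of_continuousOn
    (((hdiv.mul h.continuousOn_fst).add
      (continuousOn_const (c := ((m + e : ℝ) : ℂ)).mul h.continuousOn_snd)).mono hxy)
  refine LipschitzOnWith.absolutelyContinuousOnInterval (K := C.toNNReal) <|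
    (convex_uIcc x y).lipschitzOnWith_of_nnnorm_hasDerivWithin_le
      (fun t ht => (h t (hxy ht)).1.hasDerivWithinAt) fun t ht => ?_
  rw [← NNReal.coe_le_coe, coe_nnnorm]
  exact (hC t ht).trans (Real.le_coe_toNNReal C)

/-- A classical solution is an eigenfunction of the free radial Dirac expression. -/
theorem radialDirac_eq {k : ℤ} {φ : RadialSpinor}
    (h : DiracODE m k e s (fun r => φ r 0) (fun r => φ r 1)) {r : ℝ} (hr : r ∈ s) :
    radialDirac m k 0 φ r = (e : ℂ) • φ r := by
  funext i
  fin_cases i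
  · simp only [radialDirac, (h r hr).2.deriv, Pi.zero_apply, Fin.zero_eta, Matrix.cons_val_zero,
      Pi.smul_apply, smul_eq_mul]
    push_cast
    ring
  · simp only [radialDirac, (h r hr).1.deriv, Pi.zero_apply, Fin.mk_one, Matrix.cons_val_one,
      Matrix.cons_val_fin_one, Pi.smul_apply, smul_eq_mul]
    push_cast
    ring

end DiracODE

theorem memLp_glue {u v : ℝ → ℂ} (hu : ContinuousOn u (Ioi 0)) (hv : ContinuousOn v (Ioi 0))
    (hu2 : IntegrableOn (fun r => ‖u r‖ ^ 2) (Ioc 0 1))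
    (hv2 : IntegrableOn (fun r => ‖v r‖ ^ 2) (Ioi 1)) :
    MemLp ((Iic (1 : ℝ)).piecewise u v) 2 halfLine := by
  have h0 : Ioi (1 : ℝ) ⊆ Ioi 0 := Ioi_subset_Ioi zero_le_one
  refine MemLp.piecewise measurableSet_Iic ?_ ?_
  · rw [halfLine, Measure.restrict_restrict measurableSet_Iic, inter_comm, Ioi_inter_Iic]
    exact (memLp_two_iff_integrable_sq_norm
      ((hu.mono Ioc_subset_Ioi_self).aestronglyMeasurable measurableSet_Ioc)).2 hu2
  · rw [halfLine, compl_Iic, Measure.restrict_restrict measurableSet_Ioi,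
      inter_eq_self_of_subset_left h0]
    exact (memLp_two_iff_integrable_sq_norm
      ((hv.mono h0).aestronglyMeasurable measurableSet_Ioi)).2 hv2

theorem integrableOn_sq_of_sq_add_sq {f g : ℝ → ℂ} {s : Set ℝ} (hs : MeasurableSet s)
    (hf : ContinuousOn f s)
    (h : IntegrableOn (fun r => ‖f r‖ ^ 2 + ‖g r‖ ^ 2) s) :
    IntegrableOn (fun r => ‖f r‖ ^ 2) s := by
  refine h.mono' ((hf.norm.pow 2).aestronglyMeasurable hs) (.of_forall fun r => ?_)
  rw [Real.norm_of_nonneg (by positivity)]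
  nlinarith [sq_nonneg ‖g r‖]

/-- Two solutions on both sides of the shell, matched by the transmission condition and with the
right sign of `Re (f ḡ)`, form an eigenfunction of the shell operator. -/
theorem mem_shellPointSpectrum {m : ℝ} {k : ℤ} {a lam : ℝ} {f₁ g₁ f₂ g₂ : ℝ → ℂ}
    (h₁ : DiracODE m k a (Ioi 0) f₁ g₁) (h₂ : DiracODE m k a (Ioi 0) f₂ g₂) (ha : |a| < m)
    (hp₁ : ∀ r ∈ Ioo (0 : ℝ) 1, 0 ≤ DiracODE.crossTerm f₁ g₁ r)
    (hp₂ : ∀ r ∈ Ioi (1 : ℝ), DiracODE.crossTerm f₂ g₂ r ≤ 0)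
    (hne : (f₁ 1, g₁ 1) ≠ 0)
    (htr : (matMinus lam).mulVec ![f₂ 1, g₂ 1] + (matPlus lam).mulVec ![f₁ 1, g₁ 1] = 0) :
    (a : ℂ) ∈ shellPointSpectrum m k lam := by
  set φ : RadialSpinor := fun r =>
    ![(Iic (1 : ℝ)).piecewise f₁ f₂ r, (Iic (1 : ℝ)).piecewise g₁ g₂ r] with hφ
  have h01 : Ioi (1 : ℝ) ⊆ Ioi 0 := Ioi_subset_Ioi zero_le_one
  have hdisj : ∀ r ∈ Ioi (1 : ℝ), r ∉ Iic (1 : ℝ) := fun r hr => not_le.2 (mem_Ioi.1 hr)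
  have hleft : DiracODE m k a (Ioo 0 1) (fun r => φ r 0) (fun r => φ r 1) :=
    (h₁.mono Ioo_subset_Ioi_self).congr isOpen_Ioo
      (fun r hr => piecewise_eq_of_mem (Iic (1 : ℝ)) f₁ f₂ hr.2.le)
      (fun r hr => piecewise_eq_of_mem (Iic (1 : ℝ)) g₁ g₂ hr.2.le)
  have hright : DiracODE m k a (Ioi 1) (fun r => φ r 0) (fun r => φ r 1) :=
    (h₂.mono h01).congr isOpen_Ioi
      (fun r hr => piecewise_eq_of_notMem (Iic (1 : ℝ)) f₁ f₂ (hdisj r hr))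
      (fun r hr => piecewise_eq_of_notMem (Iic (1 : ℝ)) g₁ g₂ (hdisj r hr))
  have hode : DiracODE m k a (Ioo 0 1 ∪ Ioi 1) (fun r => φ r 0) (fun r => φ r 1) :=
    fun r hr => hr.elim (hleft r) (hright r)
  have hsub : Ioo (0 : ℝ) 1 ∪ Ioi 1 ⊆ Ioi 0 := union_subset Ioo_subset_Ioi_self h01
  have i₁ := h₁.integrableOn_Ioc_zero ha one_pos hp₁
  have i₂ := h₂.integrableOn_Ioi ha one_pos hp₂
  have hL2 : IsL2 φ := by
    intro i
    fin_cases i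
    · exact memLp_glue h₁.continuousOn_fst h₂.continuousOn_fst
        (integrableOn_sq_of_sq_add_sq measurableSet_Ioc
          (h₁.continuousOn_fst.mono Ioc_subset_Ioi_self) i₁)
        (integrableOn_sq_of_sq_add_sq measurableSet_Ioi (h₂.continuousOn_fst.mono h01) i₂)
    · simp only [add_comm (‖f₁ _‖ ^ 2)] at i₁
      simp only [add_comm (‖f₂ _‖ ^ 2)] at i₂
      exact memLp_glue h₁.continuousOn_snd h₂.continuousOn_snd
        (integrableOn_sq_of_sq_add_sq measurableSet_Ioc
          (h₁.continuousOn_snd.mono Ioc_subset_Ioi_self) i₁)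
        (integrableOn_sq_of_sq_add_sq measurableSet_Ioi (h₂.continuousOn_snd.mono h01) i₂)
  have heig : radialDirac m k 0 φ =ᵐ[halfLine] fun r => (a : ℂ) • φ r := by
    have h1 : ∀ᵐ r : ℝ, r ≠ 1 := by simp [ae_iff, measure_singleton]
    refine (ae_restrict_iff' measurableSet_Ioi).2 ?_
    filter_upwards [h1] with r hr hr0
    refine hode.radialDirac_eq ?_
    rcases lt_or_gt_of_ne hr with hr | hr
    · exact Or.inl ⟨hr0, hr⟩
    · exact Or.inr hr
  refine ⟨φ, ⟨hL2, ?_, ?_, ?_⟩, ?_, heig⟩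
  · intro i
    refine ((hL2 i).const_mul (a : ℂ)).ae_eq ?_
    filter_upwards [heig] with r hr
    rw [hr]
    rfl
  · intro i x y hxy
    fin_cases i
    · exact hode.absolutelyContinuous_fst hsub hxy
    · exact hode.swap.absolutelyContinuous_fst hsub hxy
  · refine ⟨_, _, ?_, ?_, htr⟩
    · refine Tendsto.congr' (f₁ := fun r => ![f₂ r, g₂ r]) ?_ ?_
      · filter_upwards [self_mem_nhdsWithin] with r hr
        simp only [hφ, piecewise_eq_of_notMem _ _ _ (hdisj r hr)]
      · have hc := h₂ 1 (mem_Ioi.2 one_pos)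
        refine tendsto_nhdsWithin_of_tendsto_nhds (tendsto_pi_nhds.2 fun i => ?_)
        fin_cases i
        · exact hc.1.continuousAt
        · exact hc.2.continuousAt
    · refine Tendsto.congr' (f₁ := fun r => ![f₁ r, g₁ r]) ?_ ?_
      · filter_upwards [self_mem_nhdsWithin] with r hr
        simp only [hφ, piecewise_eq_of_mem (Iic (1 : ℝ)) _ _ (mem_Iic.2 (mem_Iio.1 hr).le)]
      · have hc := h₁ 1 (mem_Ioi.2 one_pos)
        refine tendsto_nhdsWithin_of_tendsto_nhds (tendsto_pi_nhds.2 fun i => ?_)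
        fin_cases i
        · exact hc.1.continuousAt
        · exact hc.2.continuousAt
  · intro h0
    -- If `φ` vanished a.e., then by continuity the inner solution would vanish on `(0, 1)`, and by
    -- uniqueness also at `1`, against `hne`.
    have hae : (fun r => (f₁ r, g₁ r)) =ᵐ[volume.restrict (Ioo 0 1)] fun _ => 0 := by
      have h1 := ae_restrict_of_ae_restrict_of_subset (s := Ioo 0 1) Ioo_subset_Ioi_self h0
      filter_upwards [h1, ae_restrict_mem measurableSet_Ioo] with r hr hr1
      have e0 := congrFun hr 0
      have e1 := congrFun hr 1
      simp only [hφ, piecewise_eq_of_mem (Iic (1 : ℝ)) _ _ hr1.2.le] at e0 e1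
      exact Prod.ext e0 e1
    have hcont : ContinuousOn (fun r => (f₁ r, g₁ r)) (Ioi 0) :=
      h₁.continuousOn_fst.prodMk h₁.continuousOn_snd
    have heq := Measure.eqOn_open_of_ae_eq hae isOpen_Ioo (hcont.mono Ioo_subset_Ioi_self)
      continuousOn_const
    have hhalf : (1 / 2 : ℝ) ∈ Icc (1 / 2 : ℝ) 1 := by norm_num
    have hone : (1 : ℝ) ∈ Icc (1 / 2 : ℝ) 1 := by norm_num
    have hI : Icc (1 / 2 : ℝ) 1 ⊆ Ioi 0 := fun t ht => lt_of_lt_of_le (by norm_num) ht.1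
    exact hne ((h₁.mono (Ioo_subset_Icc_self.trans hI)).eq_zero (by norm_num)
      (h₁.continuousOn_fst.mono hI) (h₁.continuousOn_snd.mono hI) hhalf hone
      (heq (by norm_num)))

/-! ### The transmission condition and the limit `ε → 0` -/

/-- With `λ = 2 tan (μ / 2)`, the transmission condition says that the spinor is rotated by the
angle `μ` when passing the shell. -/
theorem transmission_rotation {μ lam : ℝ} (hcos : Real.cos (μ / 2) ≠ 0)
    (hlam : lam = 2 * Real.tan (μ / 2)) (x y : ℂ) :
    (matMinus lam).mulVec ![((Real.cos μ : ℝ) : ℂ) * x - ((Real.sin μ : ℝ) : ℂ) * y,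
        ((Real.sin μ : ℝ) : ℂ) * x + ((Real.cos μ : ℝ) : ℂ) * y] +
      (matPlus lam).mulVec ![x, y] = 0 := by
  have hs : Real.sin μ = 2 * Real.sin (μ / 2) * Real.cos (μ / 2) := by
    rw [← Real.sin_two_mul]; ring_nf
  have hc : Real.cos μ = 2 * Real.cos (μ / 2) ^ 2 - 1 := by
    rw [← Real.cos_two_mul]; ring_nf
  have hsc := Real.sin_sq_add_cos_sq (μ / 2)
  -- Both half-angle formulas for `tan (μ / 2)`; each row of the transmission condition is a linear
  -- combination of them.
  have h1 : lam / 2 * (Real.cos μ + 1) = Real.sin μ := by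
    rw [hlam, Real.tan_eq_sin_div_cos, hs, hc]
    field_simp
    ring
  have h2 : lam / 2 * Real.sin μ = 1 - Real.cos μ := by
    rw [hlam, Real.tan_eq_sin_div_cos, hs, hc]
    field_simp
    linear_combination 2 * hsc
  have h1C : (lam : ℂ) / 2 * (((Real.cos μ : ℝ) : ℂ) + 1) = ((Real.sin μ : ℝ) : ℂ) := by
    exact_mod_cast h1
  have h2C : (lam : ℂ) / 2 * ((Real.sin μ : ℝ) : ℂ) = 1 - ((Real.cos μ : ℝ) : ℂ) := by
    exact_mod_cast h2
  funext i
  fin_cases i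
  · simp only [matMinus, matPlus, Matrix.mulVec, dotProduct, Fin.sum_univ_two, Pi.add_apply,
      Matrix.of_apply, Matrix.cons_val', Matrix.cons_val_zero, Matrix.cons_val_one,
      Matrix.cons_val_fin_one, Fin.zero_eta, Pi.zero_apply]
    linear_combination x * h1C - y * h2C
  · simp only [matMinus, matPlus, Matrix.mulVec, dotProduct, Fin.sum_univ_two, Pi.add_apply,
      Matrix.of_apply, Matrix.cons_val', Matrix.cons_val_zero, Matrix.cons_val_one,
      Matrix.cons_val_fin_one, Fin.mk_one, Pi.zero_apply]
    linear_combination x * h2C + y * h1C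

/-- Limits of eigenvalues of the shrinking potentials inside the gap are eigenvalues of the shell
operator. -/
theorem mem_shellPointSpectrum_of_tendsto {m : ℝ} {k : ℤ} (hk : k ≠ 0) {μ lam : ℝ}
    (hcos : Real.cos (μ / 2) ≠ 0) (hlam : lam = 2 * Real.tan (μ / 2)) {E : Set ℝ}
    (hE : E ⊆ Ioi 0) (hE0 : (0 : ℝ) ∈ closure E) {aε : ℝ → ℝ} {a : ℝ} (ha : a ∈ Ioo (-m) m)
    (heig : ∀ ε ∈ E, (aε ε : ℂ) ∈ shortRangePointSpectrum m k μ ε)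
    (hlim : Tendsto aε (𝓝[E] 0) (𝓝 a)) :
    (a : ℂ) ∈ shellPointSpectrum m k lam := by
  have ha' : |a| < m := abs_lt.2 ha
  have hne : (𝓝[E] (0 : ℝ)).NeBot := mem_closure_iff_nhdsWithin_neBot.1 hE0
  -- Along an ultrafilter the normalized values converge by compactness of the sphere, with no
  -- subsequence to extract.
  set U : Ultrafilter ℝ := Ultrafilter.of (𝓝[E] 0) with hU
  have hUE : (U : Filter ℝ) ≤ 𝓝[E] 0 := Ultrafilter.of_le _
  have hU0 : Tendsto (fun ε : ℝ => ε) U (𝓝 0) := hUE.trans nhdsWithin_le_nhds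
  have hUa : Tendsto aε U (𝓝 a) := hlim.mono_left hUE
  have hmode : ∀ ε : ℝ, ∃ F G : ℝ → ℂ, ε ∈ E → ε < 1 →
      IsNormalizedMode m k μ ε (aε ε) F G := by
    intro ε
    by_cases h : ε ∈ E ∧ ε < 1
    · obtain ⟨F, G, hFG⟩ := exists_isNormalizedMode (hE h.1) h.2 (heig ε h.1)
      exact ⟨F, G, fun _ _ => hFG⟩
    · exact ⟨0, 0, fun h1 h2 => (h ⟨h1, h2⟩).elim⟩
  choose F G hFG using hmode
  have hev : ∀ᶠ ε in (U : Filter ℝ), IsNormalizedMode m k μ ε (aε ε) (F ε) (G ε) ∧ 0 < ε ∧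
      ε ≤ 1 / 2 ∧ |aε ε| < m := by
    filter_upwards [hUE self_mem_nhdsWithin, hU0.eventually_le_const one_half_pos,
      hUa.abs.eventually_lt_const ha'] with ε h1 h2 h3
    exact ⟨hFG ε h1 (by linarith), hE h1, h2, h3⟩
  obtain ⟨⟨x, y⟩, hw, hwlim⟩ := (isCompact_sphere (0 : ℂ × ℂ) 1).ultrafilter_le_nhds
    (U.map fun ε => (F ε (1 - ε), G ε (1 - ε))) (by
      rw [le_principal_iff]
      exact hev.mono fun ε h => by simpa using h.1.norm_eq)
  have hleft : Tendsto (fun ε => (F ε (1 - ε), G ε (1 - ε))) U (𝓝 (x, y)) := hwlim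
  have hxy : (x, y) ≠ 0 := by
    intro h0
    rw [h0] at hw
    simp at hw
  have hx := hleft.fst_nhds
  have hy := hleft.snd_nhds
  set x' : ℂ := ((Real.cos μ : ℝ) : ℂ) * x - ((Real.sin μ : ℝ) : ℂ) * y with hx'
  set y' : ℂ := ((Real.sin μ : ℝ) : ℂ) * x + ((Real.cos μ : ℝ) : ℂ) * y with hy'
  have hright : Tendsto (fun ε => (F ε (1 + ε), G ε (1 + ε))) U (𝓝 (x', y')) := by
    have h1 : Tendsto (fun ε =>
        (((Real.cos μ : ℝ) : ℂ) * F ε (1 - ε) - ((Real.sin μ : ℝ) : ℂ) * G ε (1 - ε),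
        ((Real.sin μ : ℝ) : ℂ) * F ε (1 - ε) + ((Real.cos μ : ℝ) : ℂ) * G ε (1 - ε))) U
        (𝓝 (x', y')) :=
      ((hx.const_mul _).sub (hy.const_mul _)).prodMk_nhds
        ((hx.const_mul _).add (hy.const_mul _))
    refine tendsto_of_tendsto_of_dist h1 (squeeze_zero' (.of_forall fun _ => dist_nonneg) ?_
      (by simpa using hU0.const_mul (8 * (|(k : ℝ)| + m) *
        Real.exp (2 * (|(k : ℝ)| + m) + |μ|))))
    filter_upwards [hev] with ε h
    rw [dist_comm, dist_eq_norm]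
    exact h.1.norm_sub_rotation_le h.2.1 h.2.2.1 h.2.2.2.le
  obtain ⟨f₁, g₁, hode₁, hf₁, hg₁⟩ := DiracODE.exists_solution ha' k x y
  obtain ⟨f₂, g₂, hode₂, hf₂, hg₂⟩ := DiracODE.exists_solution ha' k x' y'
  have hFc : ∀ᶠ ε in (U : Filter ℝ), ContinuousOn (F ε) (Ioi 0) := hev.mono fun ε h => h.1.cont_fst
  have hGc : ∀ᶠ ε in (U : Filter ℝ), ContinuousOn (G ε) (Ioi 0) := hev.mono fun ε h => h.1.cont_snd
  have hcross := continuous_crossTerm_value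
  refine mem_shellPointSpectrum hode₁ hode₂ ha' ?_ ?_ (by rwa [hf₁, hg₁]) ?_
  · intro r hr
    have hlt : ∀ᶠ ε in (U : Filter ℝ), ε < 1 - r := hU0.eventually_lt_const (by linarith [hr.2])
    have hconv := hode₁.tendsto hr.1 hUa (c := fun ε => 1 - ε)
      (by simpa using hU0.const_sub 1) (by
        filter_upwards [hev, hlt] with ε h h'
        rw [min_eq_left (by linarith), max_eq_right (by linarith)]
        exact h.1.left.mono (Ioo_subset_Ioo_left hr.1.le)) hFc hGc (by rwa [hf₁, hg₁])
    -- For fixed `r < 1`, the inequality `r < 1 - ε` holds eventually, so the sign of `Re (f ḡ)` at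
    -- `r` passes to the limit.
    refine ge_of_tendsto ((hcross.tendsto _).comp hconv) ?_
    filter_upwards [hev, hlt] with ε h h'
    exact h.1.crossTerm_nonneg h.2.2.2 hk hr.1 (by linarith)
  · intro r hr
    rw [mem_Ioi] at hr
    have hlt : ∀ᶠ ε in (U : Filter ℝ), ε < r - 1 := hU0.eventually_lt_const (by linarith)
    have hconv := hode₂.tendsto (by linarith) hUa (c := fun ε => 1 + ε) (r := r)
      (by simpa using hU0.const_add 1) (by
        filter_upwards [hev, hlt] with ε h h'
        rw [min_eq_right (by linarith), max_eq_left (by linarith)]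
        exact h.1.right.mono Ioo_subset_Ioi_self) hFc hGc (by rwa [hf₂, hg₂])
    refine le_of_tendsto ((hcross.tendsto _).comp hconv) ?_
    filter_upwards [hev, hlt] with ε h h'
    exact h.1.crossTerm_nonpos h.2.1 h.2.2.2 (by linarith)
  · rw [hf₁, hg₁, hf₂, hg₂]
    exact transmission_rotation hcos hlam x y

end DiracShell

end

theorem theorem4p2 (m : ℝ) (hm : 0 < m) (k : ℤ) (hk : k ≠ 0)
    (μ : ℝ) (hμ : μ ≠ 0) (hcos : Real.cos (μ / 2) ≠ 0)
    (lam : ℝ) (hlam : lam = 2 * Real.tan (μ / 2))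
    (E : Set ℝ) (hE : E ⊆ Ioi 0) (hE0 : (0 : ℝ) ∈ closure E)
    (aε : ℝ → ℝ) (a : ℝ) (ha : a ∈ Ioo (-m) m)
    (heig : ∀ ε ∈ E, (aε ε : ℂ) ∈ DiracShell.shortRangePointSpectrum m k μ ε)
    (hlim : Tendsto aε (𝓝[E] 0) (𝓝 a)) :
    (a : ℂ) ∈ DiracShell.shellPointSpectrum m k lam :=
  DiracShell.mem_shellPointSpectrum_of_tendsto hk hcos hlam hE hE0 ha heig hlim
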